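/- Consider $M\ge 1$ nodes and a common receiver, in slotted time $n=0,1,2,\dots$. Node $m$ observes a source $X^{(m)}_n\in\{0,1\}$; given the initial data in slot $0$, the sources evolve as independent two-state Markov chains with transition probabilities $q_{01},q_{10}$ (changes take place at the beginning of a slot). We write $\bar q=\frac{q_{10}}{q_{01}+q_{10}}q_{01}+\frac{q_{01}}{q_{01}+q_{10}}q_{10}$ for the average transition probability. In every slot $n\ge1$ each node, independently of everything else given whether its source changed, transmits the current source state with probability $\alpha_c$ if the source changed at the beginning of the slot, and with probability $\alpha_s$ otherwise ($\alpha_c,\alpha_s\in[0,1]$: hybrid policy). The random policy is $\alpha_c=\alpha_s=\alpha$, and the reactive policy is $\alpha_c=1,\alpha_s=0$. A packet is decoded if and only if no other node transmits in the same slot; there is no feedback. The receiver's estimate $\hat X_n$ of a given source equals $X_n$ if a packet of the corresponding node is decoded in slot $n$, and $\hat X_{n-1}$ otherwise, with $\hat X_0$ arbitrary. The initial states and initial estimates of all nodes may have any joint law; given them, the source transitions and access decisions have the law just described (in particular it does not depend on the initial estimates). Let $\delta_n=|X_n-\hat X_n|$. The age of incorrect information (AoII) is $\Omega_n=\delta_n\,(n-S[n])$,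 where $S[n]$ is the last instant $k\le n$ at which the error moves from $\delta_k=0$ to $\delta_{k+1}=1$ (and $S[n]=0$ if there is none); thus $\Omega_n=1,2,\dots$ in the successive slots of an error period. Put $$\rho=\bar q\,\alpha_c+(1-\bar q)\,\alpha_s,\qquad G=\rho M,\qquad \gamma=(1-\rho)^{M-1}.$$ Let the sources be symmetric, $q_{01}=q_{10}=\bar q\in(0,1]$. Then, for every such access policy (random, reactive or hybrid) and every node, the average AoII $\overline\Omega=\lim_{\ell\to\infty}\frac1\ell\sum_{i=1}^{\ell}\Omega_i$ exists almost surely and is the constant $$\overline\Omega=\frac{\bar q\,M^2(1-\alpha_c\gamma)}{\big[\bar qM(1-\alpha_c\gamma)+G\gamma\big]\,\big[2\bar qM(1-\alpha_c\gamma)+G\gamma\big]} .$$ Every $\Omega_n$ is integrable, and $\lim_{n\to\infty}\mathbb E[\Omega_n]=\overline\Omega$ as well, provided that $\bar q<1$ or $\alpha_c\gamma>0$ (otherwise $\delta_n$ alternates deterministically). For the random policy, with the throughput $S$, i.e. the expected number of packets decoded in a slot (for any slot $n\ge1$), this is equivalently $$\overline\Omega=\frac{\bar q\,M\,(M-S)}{\big[\bar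 qM+S(1-\bar q)\big]\,\big[2\bar qM+S(1-2\bar q)\big]} .$$ -/

import Mathlib

open MeasureTheory Filter Topology

noncomputable section

namespace AlohaAoII

/-- Channel access policies of slotted ALOHA without feedback: `random α` transmits in every slot
with probability `α`; `reactive` transmits exactly when the source changes state; `hybrid αc αs`
transmits with probability `αc` after a source transition and with probability `αs` otherwise. -/
inductive AccessPolicy where
  | random (α : unitInterval)
  | reactive
  | hybrid (αc αs : unitInterval)

/-- Transmission probability `α_c` in a slot in which the source changes state. -/
def AccessPolicy.alphaC : AccessPolicy → ℝ
  | random α => α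
  | reactive => 1
  | hybrid αc _ => αc

/-- Transmission probability `α_s` in a slot in which the source keeps its state. -/
def AccessPolicy.alphaS : AccessPolicy → ℝ
  | random α => α
  | reactive => 0
  | hybrid _ αs => αs

/-- One-step transition matrix of a two-state source. -/
def sourceMatrix (q01 q10 : ℝ) : Matrix (Fin 2) (Fin 2) ℝ :=
  !![1 - q01, q01; q10, 1 - q10]

/-- Probability that a node makes the access decision `a` (`true`: transmit) in a slot in which
its source moves from `x` to `y`. -/
def accessProb (P : AccessPolicy) (x y : Fin 2) (a : Bool) : ℝ :=
  let t := if x = y then P.alphaS else P.alphaC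
  if a then t else 1 - t

/-- Average probability `q̄ = π₀ q₀₁ + π₁ q₁₀` of a source transition, where
`π₀ = q₁₀ / (q₀₁ + q₁₀)` and `π₁ = q₀₁ / (q₀₁ + q₁₀)`. -/
def qBar (q01 q10 : ℝ) : ℝ :=
  q10 / (q01 + q10) * q01 + q01 / (q01 + q10) * q10

/-- Average probability `ρ` for a node to transmit in a slot. -/
def activity (q01 q10 : ℝ) (P : AccessPolicy) : ℝ :=
  qBar q01 q10 * P.alphaC + (1 - qBar q01 q10) * P.alphaS

/-- Channel load `G = ρ M`. -/
def load (M : ℕ) (q01 q10 : ℝ) (P : AccessPolicy) : ℝ :=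
  activity q01 q10 P * M

/-- Probability `γ = (1 - ρ) ^ (M - 1)` for a transmitted packet not to collide. -/
def successProb (M : ℕ) (q01 q10 : ℝ) (P : AccessPolicy) : ℝ :=
  (1 - activity q01 q10 P) ^ (M - 1)

variable {Ω : Type*} {M : ℕ}

/-- The system of `M` nodes. `X m n` is the state of source `m` in slot `n`, `A m n` tells whether
node `m` transmits in slot `n`, and `E m` is the initial estimate of source `m` at the receiver.
The field `law` gives the finite-dimensional distributions: from any joint initial law, the sources
evolve independently as Markov chains with matrix `sourceMatrix q01 q10` (a change from slot `k` to
slot `k + 1` takes place at the beginning of slot `k + 1`), and in every slot each node decides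
independently whether to transmit, with the probability prescribed by the policy.
(The values `A m 0` play no role.) -/
structure IsSystem [MeasurableSpace Ω] (μ : Measure Ω) (q01 q10 : ℝ) (P : AccessPolicy)
    (X : Fin M → ℕ → Ω → Fin 2) (A : Fin M → ℕ → Ω → Bool) (E : Fin M → Ω → Fin 2) : Prop where
  measurable_source : ∀ m n, Measurable (X m n)
  measurable_access : ∀ m n, Measurable (A m n)
  measurable_init : ∀ m, Measurable (E m)
  law : ∀ (N : ℕ) (e : Fin M → Fin 2) (x : Fin M → ℕ → Fin 2) (a : Fin M → ℕ → Bool),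
    μ.real {ω | ∀ m, E m ω = e m ∧ (∀ k ≤ N, X m k ω = x m k) ∧
        ∀ k < N, A m (k + 1) ω = a m (k + 1)} =
      μ.real {ω | ∀ m, E m ω = e m ∧ X m 0 ω = x m 0} *
        ∏ m, ∏ k ∈ Finset.range N,
          (sourceMatrix q01 q10 (x m k) (x m (k + 1)) *
            accessProb P (x m k) (x m (k + 1)) (a m (k + 1)))

/-- Collision channel: the packet of node `m` is decoded in slot `n` if and only if `m` is the only
node that transmits. -/
def Delivered (A : Fin M → ℕ → Ω → Bool) (m : Fin M) (n : ℕ) (ω : Ω) : Prop :=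
  A m n ω = true ∧ ∀ j, j ≠ m → A j n ω = false

open Classical in
/-- The estimate of source `m` at the receiver: refreshed when a packet of node `m` is decoded and
kept otherwise. -/
def estimate (X : Fin M → ℕ → Ω → Fin 2) (A : Fin M → ℕ → Ω → Bool) (E : Fin M → Ω → Fin 2)
    (m : Fin M) : ℕ → Ω → Fin 2
  | 0, ω => E m ω
  | n + 1, ω => if Delivered A m (n + 1) ω then X m (n + 1) ω else estimate X A E m n ω

/-- The estimation error `δ_n = |X_n - X̂_n| ∈ {0, 1}` for source `m`. -/
def err (X : Fin M → ℕ → Ω → Fin 2) (A : Fin M → ℕ → Ω → Bool) (E : Fin M → Ω → Fin 2)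
    (m : Fin M) (n : ℕ) (ω : Ω) : ℕ :=
  (((X m n ω : ℕ) : ℤ) - ((estimate X A E m n ω : ℕ) : ℤ)).natAbs

/-- `S[n]`: the last instant `k ≤ n` at which the error process moves from `0` (at `k`) to `1`
(at `k + 1`). It is `0` if there is none (so that an error already present in slot `0` is
counted from slot `0`). -/
def errStart (δ : ℕ → ℕ) (n : ℕ) : ℕ :=
  sSup {k | k ≤ n ∧ δ k = 0 ∧ δ (k + 1) = 1}

/-- The age of incorrect information `δ_n (n - S[n])` of source `m` in slot `n`. -/
def aoii (X : Fin M → ℕ → Ω → Fin 2) (A : Fin M → ℕ → Ω → Bool) (E : Fin M → Ω → Fin 2)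
    (m : Fin M) (n : ℕ) (ω : Ω) : ℝ :=
  (err X A E m n ω : ℝ) * ((n : ℝ) - (errStart (fun k => err X A E m k ω) n : ℝ))

/-- Throughput: the expected number of packets decoded in slot `n`. -/
def throughput [MeasurableSpace Ω] (μ : Measure Ω) (A : Fin M → ℕ → Ω → Bool) (n : ℕ) : ℝ :=
  ∫ ω, (Set.ncard {m | Delivered A m n ω} : ℝ) ∂μ

end AlohaAoII

end

open AlohaAoII

/-! Fix a node. Without a delivery the estimate is frozen and a binary error flips exactly when the
source changes; a delivery resets the error. By symmetry of the source, an error starts with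
probability `a = q(1 - α_c γ)` and persists with probability `b = (1 - q)(1 - α_s γ)`, whatever the
past. So the error `δ` is a two-state Markov chain and the age `Z` is a Markov-driven counter, `Z' =
δ' (Z + 1)`; this is what `IsErrorChain` abstracts. In stationarity `E δ = a / (1 - b + a)` and `E Z
= E δ / (1 - b)`, and the closed form follows from `1 - b = a + ρ γ`.

The means obey linear recursions with ratios `b - a` and `b`, which gives `tendsto_integral_age`.
For the almost sure limit, the Poisson equation of the chain is solved by a linear function of `(Z,
δ)`; adding it to the centred sum of ages leaves a martingale with bounded increment variances
(`integral_corrected_sum_sq_le`). Chebyshev along squares and monotonicity of the sum finish the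
argument (`ae_tendsto_average`).

The probabilistic input is that the steps of all nodes in one slot are independent of the history
and have a product law (`real_history_step`, `integral_mul_step`); the values of `a`, `b` and the
throughput are sums over this product law. -/

namespace AlohaAoII

/-! ### Bounded measurable functions -/

/-- Bounded functions that are measurable with respect to a given σ-algebra. -/
def BddMeas {Ω : Type*} (m : MeasurableSpace Ω) (f : Ω → ℝ) : Prop :=
  Measurable[m] f ∧ ∃ C, ∀ ω, |f ω| ≤ C

namespace BddMeas

variable {Ω : Type*} {m m' : MeasurableSpace Ω} {f g : Ω → ℝ}

theorem const (c : ℝ) : BddMeas m (fun _ => c) :=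
  ⟨measurable_const, |c|, fun _ => le_rfl⟩

theorem add (hf : BddMeas m f) (hg : BddMeas m g) : BddMeas m (fun ω => f ω + g ω) := by
  obtain ⟨hf, C, hC⟩ := hf
  obtain ⟨hg, D, hD⟩ := hg
  exact ⟨hf.add hg, C + D, fun ω => (abs_add_le _ _).trans (add_le_add (hC ω) (hD ω))⟩

theorem mul (hf : BddMeas m f) (hg : BddMeas m g) : BddMeas m (fun ω => f ω * g ω) := by
  obtain ⟨hf, C, hC⟩ := hf
  obtain ⟨hg, D, hD⟩ := hg
  refine ⟨hf.mul hg, C * D, fun ω => ?_⟩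
  rw [abs_mul]
  exact mul_le_mul (hC ω) (hD ω) (abs_nonneg _) ((abs_nonneg _).trans (hC ω))

theorem const_mul (hf : BddMeas m f) (c : ℝ) : BddMeas m (fun ω => c * f ω) :=
  (const c).mul hf

theorem sub (hf : BddMeas m f) (hg : BddMeas m g) : BddMeas m (fun ω => f ω - g ω) := by
  simpa [sub_eq_add_neg] using hf.add (hg.const_mul (-1))

theorem mono (h : m ≤ m') (hf : BddMeas m f) : BddMeas m' f :=
  ⟨hf.1.mono h le_rfl, hf.2⟩

theorem integrable {μ : Measure[m] Ω} [IsFiniteMeasure μ] (hf : BddMeas m f) :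
    Integrable f μ := by
  obtain ⟨hf, C, hC⟩ := hf
  exact Integrable.of_bound hf.aestronglyMeasurable C (Eventually.of_forall hC)

end BddMeas

/-! ### Convergence along squares and linear recursions -/

/-- If the second moments of `R l` grow at most linearly, then `R l / l` vanishes almost surely
along the squares. -/
theorem ae_tendsto_div_sq {Ω : Type*} [mΩ : MeasurableSpace Ω] {μ : Measure Ω}
    [IsFiniteMeasure μ] {R : ℕ → Ω → ℝ} (hR : ∀ l, BddMeas mΩ (R l)) {C : ℝ}
    (hC : ∀ l : ℕ, ∫ ω, R l ω * R l ω ∂μ ≤ C * (l + 1)) :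
    ∀ᵐ ω ∂μ, Tendsto (fun k : ℕ => R (k ^ 2) ω / ((k ^ 2 : ℕ) : ℝ)) atTop (𝓝 0) := by
  have hC0 : 0 ≤ C := by
    have h1 := hC 0
    have h2 : 0 ≤ ∫ ω, R 0 ω * R 0 ω ∂μ := integral_nonneg fun ω => mul_self_nonneg _
    norm_num at h1
    linarith
  set V : ℕ → Ω → ℝ := fun k ω =>
    (R (k ^ 2) ω / ((k ^ 2 : ℕ) : ℝ)) * (R (k ^ 2) ω / ((k ^ 2 : ℕ) : ℝ)) with hV
  have hVB : ∀ k, BddMeas mΩ (V k) := fun k => by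
    have := (hR (k ^ 2)).const_mul ((k ^ 2 : ℕ) : ℝ)⁻¹
    have h2 := this.mul this
    simpa [hV, div_eq_inv_mul] using h2
  have hV0 : ∀ k ω, 0 ≤ V k ω := fun k ω => mul_self_nonneg _
  have hVi : ∀ k, ∫ ω, V k ω ∂μ ≤ 2 * C * (1 / (k : ℝ) ^ 2) := by
    intro k
    rcases Nat.eq_zero_or_pos k with rfl | hk
    · simp [hV]
    have hk' : (1 : ℝ) ≤ k := by exact_mod_cast hk
    have e : ∀ ω, V k ω = (1 / (k : ℝ) ^ 4) * (R (k ^ 2) ω * R (k ^ 2) ω) := by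
      intro ω
      simp only [hV]
      push_cast
      field_simp
    simp_rw [e]
    rw [integral_const_mul]
    have h1 := hC (k ^ 2)
    push_cast at h1
    have h2 : C * ((k : ℝ) ^ 2 + 1) ≤ 2 * C * (k : ℝ) ^ 2 := by
      nlinarith [mul_le_mul_of_nonneg_left (one_le_pow₀ hk' : 1 ≤ (k : ℝ) ^ 2) hC0]
    calc (1 / (k : ℝ) ^ 4) * ∫ ω, R (k ^ 2) ω * R (k ^ 2) ω ∂μ
        ≤ (1 / (k : ℝ) ^ 4) * (2 * C * (k : ℝ) ^ 2) := by gcongr; linarith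
      _ = 2 * C * (1 / (k : ℝ) ^ 2) := by field_simp
  have hsum : Summable fun k : ℕ => 2 * C * (1 / (k : ℝ) ^ 2) :=
    (Real.summable_one_div_nat_pow.mpr one_lt_two).mul_left _
  -- Since `E V k = O(1 / k²)`, the series of the `V k` has finite expectation, so it converges
  -- almost surely and its terms vanish.
  have hfin : ∫⁻ ω, ∑' k, ENNReal.ofReal (V k ω) ∂μ ≠ ⊤ := by
    rw [lintegral_tsum fun k => (hVB k).1.ennreal_ofReal.aemeasurable]
    have : ∀ k, ∫⁻ ω, ENNReal.ofReal (V k ω) ∂μ ≤ ENNReal.ofReal (2 * C * (1 / (k : ℝ) ^ 2)) := by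
      intro k
      rw [← ofReal_integral_eq_lintegral_ofReal (hVB k).integrable
        (Eventually.of_forall (hV0 k))]
      exact ENNReal.ofReal_le_ofReal (hVi k)
    refine ne_top_of_le_ne_top ?_ (ENNReal.tsum_le_tsum this)
    exact hsum.tsum_ofReal_ne_top
  have hae := ae_lt_top (Measurable.tsum fun k => (hVB k).1.ennreal_ofReal) hfin
  filter_upwards [hae] with ω hω
  have h1 := ENNReal.tendsto_atTop_zero_of_tsum_ne_top hω.ne
  have h2 : Tendsto (fun k => V k ω) atTop (𝓝 0) := by
    have := (ENNReal.tendsto_toReal (ENNReal.zero_ne_top)).comp h1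
    simpa [Function.comp_def, ENNReal.toReal_ofReal (hV0 _ ω)] using this
  have h3 := h2.sqrt
  rw [Real.sqrt_zero] at h3
  refine (tendsto_zero_iff_abs_tendsto_zero _).mpr ?_
  simpa [hV, Real.sqrt_mul_self_eq_abs, Function.comp_def] using h3

/-- A nonnegative-increment sequence whose averages converge along the squares has convergent
averages. -/
theorem tendsto_div_of_monotone_of_tendsto_sq {u : ℕ → ℝ} {c : ℝ} (hu : Monotone u)
    (h : Tendsto (fun k : ℕ => u (k ^ 2) / ((k ^ 2 : ℕ) : ℝ)) atTop (𝓝 c)) :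
    Tendsto (fun n => u n / n) atTop (𝓝 c) := by
  refine tendsto_div_of_monotone_of_exists_subseq_tendsto_div u c hu fun a ha =>
    ⟨fun k => k ^ 2, ?_, tendsto_pow_atTop two_ne_zero, h⟩
  -- For `n ≥ 1`, `(n + 1)² ≤ n² + 3 n`, which is at most `a n²` once `n (a - 1) ≥ 3`.
  obtain ⟨K, hK⟩ := exists_nat_gt (3 / (a - 1))
  filter_upwards [eventually_ge_atTop (max K 1)] with n hn
  have h1 : (K : ℝ) ≤ n := by exact_mod_cast (le_max_left _ _).trans hn
  have h2 : (1 : ℝ) ≤ n := by exact_mod_cast (le_max_right _ _).trans hn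
  have h3 : 3 < (n : ℝ) * (a - 1) := by
    rw [← div_lt_iff₀ (by linarith)]
    linarith
  push_cast
  nlinarith

/-- A linear recursion with ratio of modulus less than one and geometrically small input
vanishes at infinity. -/
theorem tendsto_zero_of_linear_recursion {b r K : ℝ} (hb0 : 0 ≤ b) (hb : b < 1) (hr0 : 0 ≤ r)
    (hr : r < 1) {e w : ℕ → ℝ} (hw : ∀ n, |w n| ≤ K * r ^ n) (he : ∀ n, e (n + 1) = b * e n + w n) :
    Tendsto e atTop (𝓝 0) := by
  obtain ⟨s, hs, hs1⟩ := exists_between (max_lt hb hr)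
  have hbs : b < s := (le_max_left _ _).trans_lt hs
  have hrs : r < s := (le_max_right _ _).trans_lt hs
  have hs0 : 0 ≤ s := hb0.trans hbs.le
  have hK : 0 ≤ K := by simpa using (abs_nonneg _).trans (hw 0)
  -- The envelope `L s ^ n` is preserved by the recursion because `b L + K ≤ s L`. Taking `s`
  -- strictly above both ratios covers the resonant case `b = r`.
  set L := max |e 0| (K / (s - b)) with hL
  have hKL : K ≤ L * (s - b) := by
    rw [← div_le_iff₀ (by linarith)]
    exact le_max_right _ _
  have key : ∀ n, |e n| ≤ L * s ^ n := by
    intro n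
    induction n with
    | zero => simp [hL]
    | succ n ih =>
      rw [he]
      have h1 : |b * e n| ≤ b * (L * s ^ n) := by
        rw [abs_mul, abs_of_nonneg hb0]
        gcongr
      have h2 : |w n| ≤ K * s ^ n := (hw n).trans (by gcongr)
      have h3 : K * s ^ n ≤ L * (s - b) * s ^ n := by gcongr
      calc |b * e n + w n| ≤ |b * e n| + |w n| := abs_add_le _ _
        _ ≤ b * (L * s ^ n) + L * (s - b) * s ^ n := by linarith
        _ = L * s ^ (n + 1) := by ring
  refine squeeze_zero_norm key ?_
  simpa using (tendsto_pow_atTop_nhds_zero_of_lt_one hs0 hs1).const_mul L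

/-! ### The error chain: moments and limit theorems -/

/-- The error process `δ` of a source and its age `Z`, driven by indicators `U` (move from no error
to error) and `W` (persistence of an error) that are independent of the past. -/
structure IsErrorChain {Ω : Type*} [mΩ : MeasurableSpace Ω] (μ : Measure Ω)
    (ℱ : Filtration ℕ mΩ) (a b : ℝ) (U W δ Z : ℕ → Ω → ℝ) : Prop where
  bdd_U : ∀ n, BddMeas (ℱ (n + 1)) (U (n + 1))
  bdd_W : ∀ n, BddMeas (ℱ (n + 1)) (W (n + 1))
  U_mem : ∀ n ω, U (n + 1) ω = 0 ∨ U (n + 1) ω = 1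
  W_mem : ∀ n ω, W (n + 1) ω = 0 ∨ W (n + 1) ω = 1
  integral_U : ∀ n f, BddMeas (ℱ n) f → ∫ ω, f ω * U (n + 1) ω ∂μ = (∫ ω, f ω ∂μ) * a
  integral_W : ∀ n f, BddMeas (ℱ n) f → ∫ ω, f ω * W (n + 1) ω ∂μ = (∫ ω, f ω ∂μ) * b
  init_err : BddMeas (ℱ 0) (δ 0)
  init_mem : ∀ ω, δ 0 ω = 0 ∨ δ 0 ω = 1
  init_age : ∀ ω, Z 0 ω = 0
  err_succ : ∀ n ω, δ (n + 1) ω = (1 - δ n ω) * U (n + 1) ω + δ n ω * W (n + 1) ω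
  age_succ : ∀ n ω, Z (n + 1) ω = δ (n + 1) ω * (Z n ω + 1)

namespace IsErrorChain

variable {Ω : Type*} [mΩ : MeasurableSpace Ω] {μ : Measure Ω}
  {ℱ : Filtration ℕ mΩ} {a b : ℝ} {U W δ Z : ℕ → Ω → ℝ}

theorem err_mem (h : IsErrorChain μ ℱ a b U W δ Z) (n : ℕ) (ω : Ω) : δ n ω = 0 ∨ δ n ω = 1 := by
  induction n with
  | zero => exact h.init_mem ω
  | succ n ih =>
    rw [h.err_succ]
    rcases ih with e | e <;> rw [e]
    · simpa using h.U_mem n ω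
    · simpa using h.W_mem n ω

theorem age_mul_err (h : IsErrorChain μ ℱ a b U W δ Z) (n : ℕ) (ω : Ω) :
    Z n ω * δ n ω = Z n ω := by
  cases n with
  | zero => simp [h.init_age]
  | succ n =>
    rw [h.age_succ]
    rcases h.err_mem (n + 1) ω with e | e <;> simp [e]

/-- Since `Z δ = Z`, the age is zero outside error periods. This makes the next age linear in the
current `(Z, δ)`, so that its expectations close up. -/
theorem age_succ' (h : IsErrorChain μ ℱ a b U W δ Z) (n : ℕ) (ω : Ω) :
    Z (n + 1) ω = (1 - δ n ω) * U (n + 1) ω + (Z n ω + δ n ω) * W (n + 1) ω := by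
  rw [h.age_succ, h.err_succ]
  linear_combination (-U (n + 1) ω + W (n + 1) ω) * h.age_mul_err n ω

theorem age_nonneg (h : IsErrorChain μ ℱ a b U W δ Z) (n : ℕ) (ω : Ω) : 0 ≤ Z n ω := by
  induction n with
  | zero => simp [h.init_age]
  | succ n ih =>
    rw [h.age_succ]
    rcases h.err_mem (n + 1) ω with e | e <;> rw [e] <;> linarith

theorem bdd_err (h : IsErrorChain μ ℱ a b U W δ Z) (n : ℕ) : BddMeas (ℱ n) (δ n) := by
  induction n with
  | zero => exact h.init_err
  | succ n ih =>
    have ih' := ih.mono (ℱ.mono n.le_succ)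
    have := (((BddMeas.const 1).sub ih').mul (h.bdd_U n)).add (ih'.mul (h.bdd_W n))
    rwa [← funext (h.err_succ n)] at this

theorem bdd_age (h : IsErrorChain μ ℱ a b U W δ Z) (n : ℕ) : BddMeas (ℱ n) (Z n) := by
  induction n with
  | zero =>
    rw [funext h.init_age]
    exact .const 0
  | succ n ih =>
    have := (h.bdd_err (n + 1)).mul ((ih.mono (ℱ.mono n.le_succ)).add (.const 1))
    rwa [← funext (h.age_succ n)] at this

variable [IsProbabilityMeasure μ]

theorem integral_mul_U_sub (h : IsErrorChain μ ℱ a b U W δ Z) (n : ℕ) {f : Ω → ℝ}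
    (hf : BddMeas (ℱ n) f) : ∫ ω, f ω * (U (n + 1) ω - a) ∂μ = 0 := by
  have hf' := hf.mono (ℱ.le n)
  have hU := (h.bdd_U n).mono (ℱ.le _)
  simp_rw [mul_sub]
  rw [integral_sub (hf'.mul hU).integrable (hf'.mul (.const a)).integrable, h.integral_U n f hf,
    integral_mul_const, sub_self]

theorem integral_mul_W_sub (h : IsErrorChain μ ℱ a b U W δ Z) (n : ℕ) {f : Ω → ℝ}
    (hf : BddMeas (ℱ n) f) : ∫ ω, f ω * (W (n + 1) ω - b) ∂μ = 0 := by
  have hf' := hf.mono (ℱ.le n)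
  have hW := (h.bdd_W n).mono (ℱ.le _)
  simp_rw [mul_sub]
  rw [integral_sub (hf'.mul hW).integrable (hf'.mul (.const b)).integrable, h.integral_W n f hf,
    integral_mul_const, sub_self]

theorem integrable_err (h : IsErrorChain μ ℱ a b U W δ Z) (n : ℕ) : Integrable (δ n) μ :=
  ((h.bdd_err n).mono (ℱ.le n)).integrable

theorem integrable_age (h : IsErrorChain μ ℱ a b U W δ Z) (n : ℕ) : Integrable (Z n) μ :=
  ((h.bdd_age n).mono (ℱ.le n)).integrable

theorem integral_err_mem (h : IsErrorChain μ ℱ a b U W δ Z) (n : ℕ) :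
    0 ≤ ∫ ω, δ n ω ∂μ ∧ ∫ ω, δ n ω ∂μ ≤ 1 := by
  constructor
  · exact integral_nonneg fun ω => by rcases h.err_mem n ω with e | e <;> simp [e]
  · have := integral_mono (h.integrable_err n) (integrable_const (1 : ℝ)) (μ := μ)
      fun ω => by rcases h.err_mem n ω with e | e <;> simp [e]
    simpa using this

/-- Expectation of a combination of the two driving indicators. -/
theorem integral_combination (h : IsErrorChain μ ℱ a b U W δ Z) (n : ℕ) {f g : Ω → ℝ}
    (hf : BddMeas (ℱ n) f) (hg : BddMeas (ℱ n) g) :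
    ∫ ω, (f ω * U (n + 1) ω + g ω * W (n + 1) ω) ∂μ = (∫ ω, f ω ∂μ) * a + (∫ ω, g ω ∂μ) * b := by
  have hf' := hf.mono (ℱ.le n)
  have hg' := hg.mono (ℱ.le n)
  have hU := (h.bdd_U n).mono (ℱ.le _)
  have hW := (h.bdd_W n).mono (ℱ.le _)
  rw [integral_add (hf'.mul hU).integrable (hg'.mul hW).integrable, h.integral_U n f hf,
    h.integral_W n g hg]

theorem integral_err_succ (h : IsErrorChain μ ℱ a b U W δ Z) (n : ℕ) :
    ∫ ω, δ (n + 1) ω ∂μ = (1 - ∫ ω, δ n ω ∂μ) * a + (∫ ω, δ n ω ∂μ) * b := by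
  simp_rw [h.err_succ]
  rw [h.integral_combination n ((BddMeas.const 1).sub (h.bdd_err n)) (h.bdd_err n),
    integral_sub (integrable_const _) (h.integrable_err n)]
  simp

theorem integral_age_succ (h : IsErrorChain μ ℱ a b U W δ Z) (n : ℕ) :
    ∫ ω, Z (n + 1) ω ∂μ
      = (1 - ∫ ω, δ n ω ∂μ) * a + (∫ ω, Z n ω ∂μ + ∫ ω, δ n ω ∂μ) * b := by
  simp_rw [h.age_succ']
  rw [h.integral_combination n ((BddMeas.const 1).sub (h.bdd_err n))
    ((h.bdd_age n).add (h.bdd_err n)),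
    integral_sub (integrable_const _) (h.integrable_err n),
    integral_add (h.integrable_age n) (h.integrable_err n)]
  simp

/-- The expected age converges unless the chain has period two. -/
theorem tendsto_integral_age (h : IsErrorChain μ ℱ a b U W δ Z) (ha0 : 0 ≤ a) (ha1 : a < 1)
    (hb0 : 0 ≤ b) (hb1 : b < 1) :
    Tendsto (fun n => ∫ ω, Z n ω ∂μ) atTop (𝓝 (a / ((1 - b) * (1 - b + a)))) := by
  have hb : 1 - b ≠ 0 := by linarith
  have hba : 1 - b + a ≠ 0 := by linarith
  -- Deviation from the stationary error probability. Its ratio `b - a` has modulus below one; `a <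
  -- 1` excludes the alternating case `a = 1`, `b = 0`.
  set d : ℕ → ℝ := fun n => ∫ ω, δ n ω ∂μ - a / (1 - b + a) with hd
  have hdn : ∀ n, d n = (b - a) ^ n * d 0 := by
    intro n
    induction n with
    | zero => simp
    | succ n ih =>
      rw [pow_succ, mul_right_comm, ← ih]
      simp only [hd, h.integral_err_succ]
      field_simp
      ring
  have hr : |b - a| < 1 := abs_sub_lt_iff.2 ⟨by linarith, by linarith⟩
  have key := tendsto_zero_of_linear_recursion (e := fun n =>
    ∫ ω, Z n ω ∂μ - a / ((1 - b) * (1 - b + a))) (w := fun n => (b - a) * d n)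
    (K := |b - a| * |d 0|) hb0 hb1 (abs_nonneg (b - a)) hr
    (fun n => by
      rw [hdn, abs_mul, abs_mul, abs_pow]
      exact le_of_eq (by ring))
    (fun n => by
      simp only [hd, h.integral_age_succ]
      field_simp
      ring)
  simpa using key.add_const (a / ((1 - b) * (1 - b + a)))

theorem integral_age_le (h : IsErrorChain μ ℱ a b U W δ Z) (ha0 : 0 ≤ a) (ha1 : a ≤ 1)
    (hb0 : 0 ≤ b) (hb1 : b < 1) (n : ℕ) : ∫ ω, Z n ω ∂μ ≤ 2 / (1 - b) := by
  have hb : 0 < 1 - b := by linarith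
  induction n with
  | zero =>
    simp only [h.init_age, integral_zero]
    positivity
  | succ n ih =>
    obtain ⟨h0, h1⟩ := h.integral_err_mem n
    rw [h.integral_age_succ]
    have h2 : (∫ ω, Z n ω ∂μ) * b ≤ 2 / (1 - b) * b := by gcongr
    have h3 : 2 / (1 - b) * b = 2 / (1 - b) - 2 := by field_simp; ring
    nlinarith

theorem integral_age_sq_le (h : IsErrorChain μ ℱ a b U W δ Z) (ha0 : 0 ≤ a) (ha1 : a ≤ 1)
    (hb0 : 0 ≤ b) (hb1 : b < 1) (n : ℕ) :
    ∫ ω, Z n ω * Z n ω ∂μ ≤ (2 + 4 / (1 - b)) / (1 - b) := by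
  have hb : 0 < 1 - b := by linarith
  induction n with
  | zero =>
    simp only [h.init_age, mul_zero, integral_zero]
    positivity
  | succ n ih =>
    obtain ⟨h0, h1⟩ := h.integral_err_mem n
    have hz := h.integral_age_le ha0 ha1 hb0 hb1 n
    have hz0 : 0 ≤ ∫ ω, Z n ω ∂μ := integral_nonneg (h.age_nonneg n)
    -- Squaring leaves no `U W` term because `(1 - δ)(Z + δ) = 0`; the rest uses `δ² = δ`, `U² = U`,
    -- `W² = W`. The joint law of `U` and `W` is therefore never needed.
    have e : ∀ ω, Z (n + 1) ω * Z (n + 1) ω = (1 - δ n ω) * U (n + 1) ω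
        + ((Z n ω * Z n ω + 2 * Z n ω) + δ n ω) * W (n + 1) ω := by
      intro ω
      have hZ := h.age_mul_err n ω
      rw [h.age_succ']
      rcases h.err_mem n ω with e1 | e1 <;> rcases h.U_mem n ω with e2 | e2 <;>
        rcases h.W_mem n ω with e3 | e3 <;> rw [e1] at hZ <;> rw [e1, e2, e3] <;>
        first
          | ring1
          | (rw [mul_zero] at hZ; rw [← hZ]; ring)
    have hZ := h.bdd_age n
    have hZ' := hZ.mono (ℱ.le n)
    simp_rw [e]
    rw [h.integral_combination n ((BddMeas.const 1).sub (h.bdd_err n))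
      (((hZ.mul hZ).add (hZ.const_mul 2)).add (h.bdd_err n)),
      integral_sub (integrable_const _) (h.integrable_err n),
      integral_add ((hZ'.mul hZ').add (hZ'.const_mul 2)).integrable (h.integrable_err n),
      integral_add (hZ'.mul hZ').integrable (hZ'.const_mul 2).integrable, integral_const_mul]
    simp only [integral_const, probReal_univ, smul_eq_mul, mul_one]
    -- `K` is the fixed point of `K = b K + 2 + 4 / (1 - b)`, where `4 / (1 - b)` bounds the
    -- contribution of `2 Z`.
    set K := (2 + 4 / (1 - b)) / (1 - b) with hK
    have h2 : (∫ ω, Z n ω * Z n ω ∂μ) * b ≤ K * b := by gcongr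
    have h3 : K * b = K - (2 + 4 / (1 - b)) := by rw [hK]; field_simp; ring
    have h4 : 4 / (1 - b) = 2 * (2 / (1 - b)) := by ring
    have h5 : (2 * ∫ ω, Z n ω ∂μ) * b ≤ 4 / (1 - b) := by rw [h4]; nlinarith
    nlinarith

/-- The centred sum of ages, corrected by a function of the current state, is a martingale whose
second moment grows at most linearly. -/
theorem integral_corrected_sum_sq_le (h : IsErrorChain μ ℱ a b U W δ Z) (ha0 : 0 ≤ a)
    (ha1 : a ≤ 1) (hb0 : 0 ≤ b) (hb1 : b < 1) {p c : ℝ} (hp : p * (1 - b) = 1)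
    (hc : c * (1 - b + a) = p) {Y : ℕ → Ω → ℝ}
    (hY : ∀ n ω, Y n ω = ∑ i ∈ Finset.range n, Z (i + 1) ω - n * (a * c) + (p - 1) * Z n ω
      + (c - p) * δ n ω) :
    (∀ n, BddMeas (ℱ n) (Y n)) ∧ ∃ C, ∀ n : ℕ, ∫ ω, Y n ω * Y n ω ∂μ ≤ C * (n + 1) := by
  -- The martingale increment: past-measurable factors times centred indicators. The equations `hp`
  -- and `hc` are the Poisson equation, cancelling the drift in `Z` and in `δ` respectively.
  set D : ℕ → Ω → ℝ := fun n ω =>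
    (c * (1 - δ n ω)) * (U (n + 1) ω - a) + (p * Z n ω + c * δ n ω) * (W (n + 1) ω - b) with hD
  have hsucc : ∀ n ω, Y (n + 1) ω = Y n ω + D n ω := by
    intro n ω
    simp only [hY, hD, Finset.sum_range_succ, h.err_succ, h.age_succ']
    push_cast
    linear_combination (-Z n ω) * hp - (δ n ω) * hc
  have hf : ∀ n, BddMeas (ℱ n) (fun ω => c * (1 - δ n ω)) := fun n =>
    ((BddMeas.const 1).sub (h.bdd_err n)).const_mul c
  have hg : ∀ n, BddMeas (ℱ n) (fun ω => p * Z n ω + c * δ n ω) := fun n =>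
    ((h.bdd_age n).const_mul p).add ((h.bdd_err n).const_mul c)
  have hUa : ∀ n, BddMeas (ℱ (n + 1)) (fun ω => U (n + 1) ω - a) := fun n =>
    (h.bdd_U n).sub (.const a)
  have hWb : ∀ n, BddMeas (ℱ (n + 1)) (fun ω => W (n + 1) ω - b) := fun n =>
    (h.bdd_W n).sub (.const b)
  have hDB : ∀ n, BddMeas (ℱ (n + 1)) (D n) := fun n =>
    (((hf n).mono (ℱ.mono n.le_succ)).mul (hUa n)).add
      (((hg n).mono (ℱ.mono n.le_succ)).mul (hWb n))
  have hYB : ∀ n, BddMeas (ℱ n) (Y n) := by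
    intro n
    induction n with
    | zero =>
      have : Y 0 = fun ω => (p - 1) * Z 0 ω + (c - p) * δ 0 ω := by
        ext ω
        simp [hY]
      rw [this]
      exact ((h.bdd_age 0).const_mul _).add ((h.bdd_err 0).const_mul _)
    | succ n ih =>
      rw [funext (hsucc n)]
      exact (ih.mono (ℱ.mono n.le_succ)).add (hDB n)
  refine ⟨hYB, ?_⟩
  set S := (2 + 4 / (1 - b)) / (1 - b) with hS
  have hb : 0 < 1 - b := by linarith
  have hS0 : 0 ≤ S := by positivity
  -- Two uses of `(x + y)² ≤ 2 x² + 2 y²` give `D² ≤ 2 c² + 2 (2 p² Z² + 2 c²)`.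
  set K := 6 * c ^ 2 + 4 * p ^ 2 with hK
  have hK0 : 0 ≤ K := by positivity
  have hDD : ∀ n, ∫ ω, D n ω * D n ω ∂μ ≤ K * (S + 1) := by
    intro n
    have hZ' := (h.bdd_age n).mono (ℱ.le n)
    have hD' := (hDB n).mono (ℱ.le _)
    have hpt : ∀ ω, D n ω * D n ω ≤ K * (Z n ω * Z n ω + 1) := by
      intro ω
      have hu : (U (n + 1) ω - a) ^ 2 ≤ 1 := by
        rcases h.U_mem n ω with e | e <;> rw [e] <;> nlinarith
      have hw : (W (n + 1) ω - b) ^ 2 ≤ 1 := by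
        rcases h.W_mem n ω with e | e <;> rw [e] <;> nlinarith
      have hd : (1 - δ n ω) ^ 2 ≤ 1 ∧ δ n ω ^ 2 ≤ 1 := by
        rcases h.err_mem n ω with e | e <;> rw [e] <;> norm_num
      have h1 : ((c * (1 - δ n ω)) * (U (n + 1) ω - a)) ^ 2 ≤ c ^ 2 := by
        rw [mul_pow, mul_pow]
        calc c ^ 2 * (1 - δ n ω) ^ 2 * (U (n + 1) ω - a) ^ 2 ≤ c ^ 2 * 1 * 1 := by
              gcongr
              exact hd.1
          _ = c ^ 2 := by ring
      have h2 : (p * Z n ω + c * δ n ω) ^ 2 ≤ 2 * p ^ 2 * Z n ω ^ 2 + 2 * c ^ 2 := by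
        have : c ^ 2 * δ n ω ^ 2 ≤ c ^ 2 * 1 := by
          gcongr
          exact hd.2
        nlinarith [sq_nonneg (p * Z n ω - c * δ n ω)]
      have h3 : ((p * Z n ω + c * δ n ω) * (W (n + 1) ω - b)) ^ 2
          ≤ 2 * p ^ 2 * Z n ω ^ 2 + 2 * c ^ 2 := by
        rw [mul_pow]
        exact (mul_le_of_le_one_right (sq_nonneg _) hw).trans h2
      have h4 : D n ω * D n ω ≤ 2 * ((c * (1 - δ n ω)) * (U (n + 1) ω - a)) ^ 2
          + 2 * ((p * Z n ω + c * δ n ω) * (W (n + 1) ω - b)) ^ 2 := by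
        simp only [hD]
        rw [← sq]
        exact (add_sq_le).trans (le_of_eq (by ring))
      have h5 : 0 ≤ c ^ 2 * Z n ω ^ 2 := by positivity
      have h6 : 0 ≤ p ^ 2 := by positivity
      rw [hK]
      nlinarith
    have := integral_mono (hD'.mul hD').integrable (((hZ'.mul hZ').add (.const 1)).const_mul
      K).integrable (μ := μ) hpt
    refine this.trans ?_
    rw [integral_const_mul, integral_add (hZ'.mul hZ').integrable (integrable_const _)]
    simp only [integral_const, probReal_univ, smul_eq_mul, mul_one]
    have := h.integral_age_sq_le ha0 ha1 hb0 hb1 n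
    gcongr
  refine ⟨∫ ω, Y 0 ω * Y 0 ω ∂μ + K * (S + 1), fun n => ?_⟩
  have hY0 : 0 ≤ ∫ ω, Y 0 ω * Y 0 ω ∂μ := integral_nonneg fun ω => mul_self_nonneg _
  induction n with
  | zero =>
    have : 0 ≤ K * (S + 1) := by positivity
    simpa using this
  | succ n ih =>
    have hY' := (hYB n).mono (ℱ.le n)
    have hD' := (hDB n).mono (ℱ.le _)
    -- The cross terms have mean zero, so the second moment of `Y` grows only by that of `D`.
    have e : ∀ ω, Y (n + 1) ω * Y (n + 1) ω = Y n ω * Y n ω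
        + (2 * ((Y n ω * (c * (1 - δ n ω))) * (U (n + 1) ω - a))
          + 2 * ((Y n ω * (p * Z n ω + c * δ n ω)) * (W (n + 1) ω - b))) + D n ω * D n ω := by
      intro ω
      rw [hsucc]
      simp only [hD]
      ring
    have i1 := ((hY'.mul ((hf n).mono (ℱ.le _))).mul ((hUa n).mono (ℱ.le _))).const_mul 2
    have i2 := ((hY'.mul ((hg n).mono (ℱ.le _))).mul ((hWb n).mono (ℱ.le _))).const_mul 2
    simp_rw [e]
    rw [integral_add ((hY'.mul hY').add (i1.add i2)).integrable (hD'.mul hD').integrable,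
      integral_add (hY'.mul hY').integrable (i1.add i2).integrable,
      integral_add i1.integrable i2.integrable,
      integral_const_mul, integral_const_mul, h.integral_mul_U_sub n ((hYB n).mul (hf n)),
      h.integral_mul_W_sub n ((hYB n).mul (hg n))]
    push_cast
    linarith [hDD n]

/-- The time average of the age converges almost surely. -/
theorem ae_tendsto_average (h : IsErrorChain μ ℱ a b U W δ Z) (ha0 : 0 ≤ a) (ha1 : a ≤ 1)
    (hb0 : 0 ≤ b) (hb1 : b < 1) :
    ∀ᵐ ω ∂μ, Tendsto (fun l : ℕ => (∑ i ∈ Finset.range l, Z (i + 1) ω) / l) atTop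
      (𝓝 (a / ((1 - b) * (1 - b + a)))) := by
  have hb : 1 - b ≠ 0 := by linarith
  have hba : 1 - b + a ≠ 0 := by linarith
  set p := 1 / (1 - b) with hp
  set c := p / (1 - b + a) with hc
  have hac : a / ((1 - b) * (1 - b + a)) = a * c := by
    rw [hc, hp]
    field_simp
  rw [hac]
  obtain ⟨hYB, C, hC⟩ := h.integral_corrected_sum_sq_le ha0 ha1 hb0 hb1 (p := p) (c := c)
    (by rw [hp]; field_simp) (by rw [hc]; field_simp) (fun _ _ => rfl)
  have hY := ae_tendsto_div_sq (fun n => (hYB n).mono (ℱ.le n)) hC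
  have hZ := ae_tendsto_div_sq (μ := μ) (fun n => (h.bdd_age n).mono (ℱ.le n))
    (C := (2 + 4 / (1 - b)) / (1 - b)) (fun n => by
      have h1 := h.integral_age_sq_le ha0 ha1 hb0 hb1 n
      have h2 : 0 < 1 - b := by linarith
      have h3 : 0 ≤ (2 + 4 / (1 - b)) / (1 - b) * n := by positivity
      linarith)
  have hδ := ae_tendsto_div_sq (μ := μ) (fun n => (h.bdd_err n).mono (ℱ.le n))
    (C := 1) (fun n => by
      have h1 : ∀ ω, δ n ω * δ n ω = δ n ω := fun ω => by
        rcases h.err_mem n ω with e | e <;> simp [e]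
      simp_rw [h1]
      have := (h.integral_err_mem n).2
      have h3 : (0 : ℝ) ≤ n := by positivity
      linarith)
  filter_upwards [hY, hZ, hδ] with ω h1 h2 h3
  have hmono : Monotone fun l : ℕ => ∑ i ∈ Finset.range l, Z (i + 1) ω :=
    monotone_nat_of_le_succ fun n => by
      rw [Finset.sum_range_succ]
      linarith [h.age_nonneg (n + 1) ω]
  refine tendsto_div_of_monotone_of_tendsto_sq hmono ?_
  -- The sum of ages is recovered from `Y`; both correction terms are negligible after division.
  have h4 := ((h1.sub (h2.const_mul (p - 1))).sub (h3.const_mul (c - p))).add_const (a * c)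
  simp only [mul_zero, sub_zero, zero_add] at h4
  refine h4.congr' ?_
  filter_upwards [eventually_ge_atTop 1] with k hk
  have hk : ((k ^ 2 : ℕ) : ℝ) ≠ 0 := by positivity
  field_simp
  ring

end IsErrorChain
-- Pathwise recursion for the age
section ErrorAge

variable {δ : ℕ → ℕ}

theorem errStart_succ_of_eq_zero {n : ℕ} (h0 : δ n = 0) (h1 : δ (n + 1) = 1) :
    errStart δ (n + 1) = n := by
  refine IsGreatest.csSup_eq ⟨⟨n.le_succ, h0, h1⟩, ?_⟩
  rintro k ⟨hk, hk0, -⟩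
  rcases hk.lt_or_eq with h | rfl
  · omega
  · omega

theorem errStart_succ_of_eq_one {n : ℕ} (h1 : δ (n + 1) = 1) :
    errStart δ (n + 1) = errStart δ n := by
  unfold errStart
  congr 1
  ext k
  constructor
  · rintro ⟨hk, hk0, hk1⟩
    have : k ≠ n + 1 := by
      rintro rfl
      omega
    exact ⟨by omega, hk0, hk1⟩
  · rintro ⟨hk, hk0, hk1⟩
    exact ⟨by omega, hk0, hk1⟩

theorem errStart_zero : errStart δ 0 = 0 := by
  have h : {k | k ≤ 0 ∧ δ k = 0 ∧ δ (k + 1) = 1} ⊆ {0} := fun k hk => Nat.le_zero.1 hk.1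
  unfold errStart
  rcases Set.subset_singleton_iff_eq.1 h with e | e <;> rw [e] <;> simp

/-- When `δ n = 0` the set defining `errStart δ n` may contain `n` itself, depending on `δ (n + 1)`;
the factor `δ n` makes this value irrelevant. Along an error period the start is constant, and at
its first slot it is the preceding slot, so the age is one. -/
theorem age_recursion (hδ : ∀ n, δ n = 0 ∨ δ n = 1) (n : ℕ) :
    (δ (n + 1) : ℝ) * (((n + 1 : ℕ) : ℝ) - errStart δ (n + 1))
      = δ (n + 1) * (δ n * ((n : ℝ) - errStart δ n) + 1) := by
  rcases hδ (n + 1) with h1 | h1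
  · simp [h1]
  rcases hδ n with h0 | h0
  · rw [errStart_succ_of_eq_zero h0 h1, h0]
    push_cast
    ring
  · rw [errStart_succ_of_eq_one h1, h0]
    push_cast
    ring

end ErrorAge

/-! ### Law of one slot and independence from the past -/

variable {Ω : Type*} {M : ℕ}

/-- The steps of all nodes in a slot: whether the source changed and whether the node transmits. -/
def step (X : Fin M → ℕ → Ω → Fin 2) (A : Fin M → ℕ → Ω → Bool) (n : ℕ) (ω : Ω) :
    Fin M → Bool × Bool :=
  fun m => (decide (X m n ω ≠ X m (n + 1) ω), A m (n + 1) ω)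

/-- Everything that happened up to slot `n`. -/
def history (X : Fin M → ℕ → Ω → Fin 2) (A : Fin M → ℕ → Ω → Bool) (E : Fin M → Ω → Fin 2)
    (n : ℕ) (ω : Ω) : Fin M → Fin 2 × (Fin (n + 1) → Fin 2) × (Fin n → Bool) :=
  fun m => (E m ω, fun k => X m k ω, fun k => A m (k + 1) ω)

/-- Law of the step of one node with a symmetric source. -/
def nodeProb (q : ℝ) (P : AccessPolicy) (u : Bool × Bool) : ℝ :=
  (if u.1 then q else 1 - q) *
    (if u.2 then (if u.1 then P.alphaC else P.alphaS)
      else 1 - (if u.1 then P.alphaC else P.alphaS))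

/-- The packet of node `m` is decoded in a slot with step `v`. -/
def Decoded (m : Fin M) (v : Fin M → Bool × Bool) : Prop :=
  (v m).2 = true ∧ ∀ j, j ≠ m → (v j).2 = false

theorem history_eq_iff {X : Fin M → ℕ → Ω → Fin 2} {A : Fin M → ℕ → Ω → Bool}
    {E : Fin M → Ω → Fin 2} {n : ℕ} {ω ω' : Ω} :
    history X A E n ω = history X A E n ω' ↔ ∀ m, E m ω = E m ω' ∧
      (∀ k ≤ n, X m k ω = X m k ω') ∧ ∀ k < n, A m (k + 1) ω = A m (k + 1) ω' := by
  simp only [history, funext_iff, Prod.mk.injEq, Fin.forall_iff, Nat.lt_succ_iff]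

theorem sourceMatrix_flip (q : ℝ) (y : Fin 2) (c : Bool) :
    sourceMatrix q q y (if c then y + 1 else y) = if c then q else 1 - q := by
  fin_cases y <;> cases c <;> simp [sourceMatrix]

theorem accessProb_flip (P : AccessPolicy) (y : Fin 2) (c t : Bool) :
    accessProb P y (if c then y + 1 else y) t
      = if t then (if c then P.alphaC else P.alphaS)
        else 1 - (if c then P.alphaC else P.alphaS) := by
  fin_cases y <;> cases c <;> cases t <;> simp [accessProb]

theorem eq_flip_iff : ∀ (y z : Fin 2) (c : Bool),
    z = (if c then y + 1 else y) ↔ decide (y ≠ z) = c := by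
  decide

section Law

variable [MeasurableSpace Ω] {μ : Measure Ω} {q : ℝ} {P : AccessPolicy}
  {X : Fin M → ℕ → Ω → Fin 2} {A : Fin M → ℕ → Ω → Bool} {E : Fin M → Ω → Fin 2}

namespace IsSystem

/-- An attained history followed by a step is a cylinder of length `n + 1`, since the last state and
the change flag determine the next state. Its law differs from that of length `n` by the last
factors only, and symmetry makes these independent of the current states. -/
theorem real_history_step (h : IsSystem μ q q P X A E) (n : ℕ)
    (a : Fin M → Fin 2 × (Fin (n + 1) → Fin 2) × (Fin n → Bool)) (v : Fin M → Bool × Bool) :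
    μ.real {ω | history X A E n ω = a ∧ step X A n ω = v}
      = μ.real {ω | history X A E n ω = a} * ∏ m, nodeProb q P (v m) := by
  by_cases hne : ∃ ω₀, history X A E n ω₀ = a
  swap
  · push Not at hne
    have h1 : {ω | history X A E n ω = a} = ∅ := Set.eq_empty_of_forall_notMem hne
    have h2 : {ω | history X A E n ω = a ∧ step X A n ω = v} = ∅ :=
      Set.eq_empty_of_forall_notMem fun ω hω => hne ω hω.1
    rw [h1, h2]
    simp
  -- Extend the trajectory of `ω₀` by the step `v`, to have arguments for `law`.
  obtain ⟨ω₀, rfl⟩ := hne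
  set x : Fin M → ℕ → Fin 2 := fun m k => if k ≤ n then X m k ω₀ else
    if (v m).1 then X m n ω₀ + 1 else X m n ω₀ with hx
  set t : Fin M → ℕ → Bool := fun m k => if k ≤ n then A m k ω₀ else (v m).2 with ht
  have hxk : ∀ m, ∀ k ≤ n, x m k = X m k ω₀ := fun m k hk => if_pos hk
  have hxs : ∀ m, x m (n + 1) = if (v m).1 then X m n ω₀ + 1 else X m n ω₀ :=
    fun m => if_neg (by omega)
  have htk : ∀ m, ∀ k < n, t m (k + 1) = A m (k + 1) ω₀ := fun m k hk => if_pos hk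
  have hts : ∀ m, t m (n + 1) = (v m).2 := fun m => if_neg (by omega)
  have e1 : {ω | history X A E n ω = history X A E n ω₀} = {ω | ∀ m, E m ω = E m ω₀ ∧
      (∀ k ≤ n, X m k ω = x m k) ∧ ∀ k < n, A m (k + 1) ω = t m (k + 1)} := by
    ext ω
    simp only [Set.mem_ofPred_eq, history_eq_iff]
    refine forall_congr' fun m => and_congr_right fun _ => and_congr ?_ ?_
    · exact forall₂_congr fun k hk => by rw [hxk m k hk]
    · exact forall₂_congr fun k hk => by rw [htk m k hk]
  have e2 : {ω | history X A E n ω = history X A E n ω₀ ∧ step X A n ω = v} =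
      {ω | ∀ m, E m ω = E m ω₀ ∧ (∀ k ≤ n + 1, X m k ω = x m k) ∧
        ∀ k < n + 1, A m (k + 1) ω = t m (k + 1)} := by
    rw [Set.ofPred_and, e1]
    ext ω
    simp only [Set.mem_inter_iff, Set.mem_ofPred_eq, funext_iff (f := step X A n ω)]
    rw [← forall_and]
    refine forall_congr' fun m => ?_
    have hs : X m n ω = X m n ω₀ →
        (step X A n ω m = v m ↔ X m (n + 1) ω = x m (n + 1) ∧ A m (n + 1) ω = t m (n + 1)) := by
      intro hX
      rw [hxs, hts, ← hX, eq_flip_iff, step, Prod.ext_iff]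
    constructor
    · rintro ⟨⟨hE, hX, hA⟩, hv⟩
      obtain ⟨h1, h2⟩ := (hs ((hX n le_rfl).trans (hxk m n le_rfl))).1 hv
      refine ⟨hE, fun k hk => ?_, fun k hk => ?_⟩
      · rcases Nat.le_succ_iff.1 hk with hk | rfl
        exacts [hX k hk, h1]
      · rcases Nat.lt_succ_iff_lt_or_eq.1 hk with hk | rfl
        exacts [hA k hk, h2]
    · rintro ⟨hE, hX, hA⟩
      refine ⟨⟨hE, fun k hk => hX k (by omega), fun k hk => hA k (by omega)⟩, ?_⟩
      exact (hs ((hX n (by omega)).trans (hxk m n le_rfl))).2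
        ⟨hX _ le_rfl, hA _ (by omega)⟩
  rw [e1, e2, h.law, h.law, mul_assoc]
  congr 1
  simp_rw [Finset.prod_range_succ]
  rw [Finset.prod_mul_distrib]
  congr 1
  refine Finset.prod_congr rfl fun m _ => ?_
  rw [hxs, hxk m n le_rfl, hts, sourceMatrix_flip, accessProb_flip, nodeProb]

theorem measurable_history (h : IsSystem μ q q P X A E) (n : ℕ) :
    Measurable (history X A E n) :=
  measurable_pi_lambda _ fun m => (h.measurable_init m).prodMk
    ((measurable_pi_lambda _ fun k : Fin (n + 1) => h.measurable_source m k).prodMk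
      (measurable_pi_lambda _ fun k : Fin n => h.measurable_access m (k + 1)))

/-- The history of the system as a filtration. -/
def filtration (h : IsSystem μ q q P X A E) : Filtration ℕ ‹MeasurableSpace Ω› where
  seq n := MeasurableSpace.comap (history X A E n) inferInstance
  mono' := by
    intro i j hij
    rintro _ ⟨s, -, rfl⟩
    refine ⟨(fun a m => ((a m).1, fun k => (a m).2.1 (Fin.castLE (by omega) k),
      fun k => (a m).2.2 (Fin.castLE hij k))) ⁻¹' s, .of_discrete, rfl⟩
  le' n := (h.measurable_history n).comap_le

theorem measurable_step_filtration (h : IsSystem μ q q P X A E) (n : ℕ) :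
    Measurable[h.filtration (n + 1)] (step X A n) := by
  rintro s -
  exact ⟨(fun a m => (decide ((a m).2.1 (Fin.castSucc (Fin.last n)) ≠ (a m).2.1 (Fin.last (n + 1))),
      (a m).2.2 (Fin.last n))) ⁻¹' s, .of_discrete, rfl⟩

theorem measurable_step (h : IsSystem μ q q P X A E) (n : ℕ) : Measurable (step X A n) :=
  (h.measurable_step_filtration n).mono (h.filtration.le _) le_rfl

theorem bddMeas_step (h : IsSystem μ q q P X A E) (n : ℕ) (g : (Fin M → Bool × Bool) → ℝ) :
    BddMeas (h.filtration (n + 1)) (fun ω => g (step X A n ω)) := by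
  refine ⟨(Measurable.of_discrete (f := g)).comp (h.measurable_step_filtration n),
    ∑ v, |g v|, fun ω => ?_⟩
  exact Finset.single_le_sum (f := fun v => |g v|) (fun v _ => abs_nonneg _) (Finset.mem_univ _)

variable [IsProbabilityMeasure μ]

/-- Summing `real_history_step` over the finitely many histories removes the conditioning. -/
theorem real_step (h : IsSystem μ q q P X A E) (n : ℕ) (v : Fin M → Bool × Bool) :
    μ.real {ω | step X A n ω = v} = ∏ m, nodeProb q P (v m) := by
  have hm := h.measurable_history n
  have h1 := sum_measureReal_preimage_singleton (μ := μ.restrict {ω | step X A n ω = v})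
    Finset.univ (f := history X A E n) (fun a _ => hm (measurableSet_singleton a))
  have h2 := sum_measureReal_preimage_singleton (μ := μ)
    Finset.univ (f := history X A E n) (fun a _ => hm (measurableSet_singleton a))
  have h3 : ∀ a, (μ.restrict {ω | step X A n ω = v}).real (history X A E n ⁻¹' {a})
      = μ.real (history X A E n ⁻¹' {a}) * ∏ m, nodeProb q P (v m) := by
    intro a
    rw [measureReal_restrict_apply (hm (measurableSet_singleton a))]
    exact h.real_history_step n a v
  simp_rw [h3, ← Finset.sum_mul, h2] at h1
  simpa using h1.symm

theorem indepFun_history_step (h : IsSystem μ q q P X A E) (n : ℕ) :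
    ProbabilityTheory.IndepFun (history X A E n) (step X A n) μ := by
  have hh := h.measurable_history n
  have hs := h.measurable_step n
  rw [ProbabilityTheory.indepFun_iff_map_prod_eq_prod_map_map hh.aemeasurable hs.aemeasurable]
  refine Measure.ext_of_singleton fun ⟨a, v⟩ => ?_
  have key := h.real_history_step n a v
  rw [← h.real_step n v] at key
  rw [← Set.singleton_prod_singleton, Measure.prod_prod,
    Measure.map_apply hh (measurableSet_singleton _),
    Measure.map_apply hs (measurableSet_singleton _),
    Measure.map_apply (hh.prodMk hs)
      ((measurableSet_singleton _).prod (measurableSet_singleton _)),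
    ← ENNReal.toReal_eq_toReal_iff' (measure_ne_top _ _)
      (ENNReal.mul_ne_top (measure_ne_top _ _) (measure_ne_top _ _)), ENNReal.toReal_mul]
  exact key

theorem integral_step (h : IsSystem μ q q P X A E) (n : ℕ) (g : (Fin M → Bool × Bool) → ℝ) :
    ∫ ω, g (step X A n ω) ∂μ = ∑ v, (∏ m, nodeProb q P (v m)) * g v := by
  have hs := h.measurable_step n
  rw [← integral_map hs.aemeasurable (Measurable.of_discrete (f := g)).aestronglyMeasurable,
    integral_fintype .of_finite]
  refine Finset.sum_congr rfl fun v _ => ?_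
  rw [map_measureReal_apply hs (measurableSet_singleton v), smul_eq_mul, ← h.real_step n v]
  rfl

theorem integral_mul_step (h : IsSystem μ q q P X A E) (n : ℕ) (g : (Fin M → Bool × Bool) → ℝ)
    (f : Ω → ℝ) (hf : BddMeas (h.filtration n) f) :
    ∫ ω, f ω * g (step X A n ω) ∂μ = (∫ ω, f ω ∂μ) * ∑ v, (∏ m, nodeProb q P (v m)) * g v := by
  rw [← h.integral_step n g]
  have hi : ProbabilityTheory.IndepFun f (fun ω => g (step X A n ω)) μ := by
    have h1 := h.indepFun_history_step n
    rw [ProbabilityTheory.IndepFun_iff_Indep] at h1 ⊢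
    refine ProbabilityTheory.indep_of_indep_of_le_left
      (ProbabilityTheory.indep_of_indep_of_le_right h1 ?_) hf.1.comap_le
    rintro _ ⟨s, -, rfl⟩
    exact ⟨g ⁻¹' s, .of_discrete, rfl⟩
  exact hi.integral_fun_mul_eq_mul_integral
    (hf.mono (h.filtration.le n)).integrable.aestronglyMeasurable
    ((h.bddMeas_step n g).mono (h.filtration.le _)).integrable.aestronglyMeasurable

end IsSystem

end Law

/-! ### Delivery probabilities -/

/-- Expectation of a product of functions of the steps of the single nodes. -/
theorem sum_prod_nodeProb (q : ℝ) (P : AccessPolicy) (m : Fin M) (φ ψ : Bool × Bool → ℝ) :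
    ∑ v : Fin M → Bool × Bool, (∏ j, nodeProb q P (v j)) *
        (φ (v m) * ∏ j ∈ Finset.univ.erase m, ψ (v j))
      = (∑ u, nodeProb q P u * φ u) * (∑ u, nodeProb q P u * ψ u) ^ (M - 1) := by
  classical
  have h1 : ∀ v : Fin M → Bool × Bool, (∏ j, nodeProb q P (v j)) *
        (φ (v m) * ∏ j ∈ Finset.univ.erase m, ψ (v j))
      = ∏ j, nodeProb q P (v j) * (if j = m then φ (v j) else ψ (v j)) := by
    intro v
    rw [Finset.prod_mul_distrib]
    congr 1
    rw [← Finset.mul_prod_erase _ _ (Finset.mem_univ m), if_pos rfl]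
    congr 1
    exact Finset.prod_congr rfl fun j hj => (if_neg (Finset.ne_of_mem_erase hj)).symm
  simp_rw [h1]
  -- Distributivity: the sum over all joint steps of a product is the product of the one-node sums.
  have h2 := Finset.prod_univ_sum (fun _ : Fin M => (Finset.univ : Finset (Bool × Bool)))
    (fun j u => nodeProb q P u * (if j = m then φ u else ψ u))
  rw [Fintype.piFinset_univ] at h2
  rw [← h2, ← Finset.mul_prod_erase _ _ (Finset.mem_univ m)]
  simp only [if_true]
  congr 1
  rw [Finset.prod_congr (g := fun _ => ∑ u, nodeProb q P u * ψ u) rfl fun j hj => by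
    simp only [if_neg (Finset.ne_of_mem_erase hj)]]
  simp

/-- Puts decoding in the product form required by `sum_prod_nodeProb`. -/
theorem decoded_indicator (m : Fin M) (v : Fin M → Bool × Bool) [Decidable (Decoded m v)] :
    (if Decoded m v then (1 : ℝ) else 0) = (if (v m).2 then 1 else 0) *
      ∏ j ∈ Finset.univ.erase m, (if (v j).2 then (0 : ℝ) else 1) := by
  by_cases hd : Decoded m v
  · rw [if_pos hd, if_pos hd.1, one_mul]
    refine (Finset.prod_eq_one fun j hj => ?_).symm
    simp [hd.2 j (Finset.ne_of_mem_erase hj)]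
  · rw [if_neg hd]
    by_cases hm : (v m).2 = true
    · have : ∃ j, j ≠ m ∧ (v j).2 = true := by
        by_contra! hc
        exact hd ⟨hm, fun j hj => by simpa using hc j hj⟩
      obtain ⟨j, hj, hj2⟩ := this
      rw [Finset.prod_eq_zero (Finset.mem_erase.2 ⟨hj, Finset.mem_univ j⟩) (by simp [hj2]),
        mul_zero]
    · rw [if_neg hm, zero_mul]

theorem sum_nodeProb_idle (q : ℝ) (P : AccessPolicy) :
    ∑ u, nodeProb q P u * (if u.2 then (0 : ℝ) else 1)
      = 1 - (q * P.alphaC + (1 - q) * P.alphaS) := by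
  simp only [Fintype.sum_prod_type, Fintype.sum_bool, nodeProb]
  simp
  ring

theorem sum_nodeProb (q : ℝ) (P : AccessPolicy) : ∑ u, nodeProb q P u = 1 := by
  simp only [Fintype.sum_prod_type, Fintype.sum_bool, nodeProb]
  simp
  ring

/-- Probability that the change indicator of node `m` is `c` and its packet is not decoded. -/
theorem sum_not_decoded (q : ℝ) (P : AccessPolicy) (m : Fin M) (c : Bool)
    [∀ v, Decidable (Decoded m v)] :
    ∑ v : Fin M → Bool × Bool, (∏ j, nodeProb q P (v j)) *
        (if (v m).1 = c ∧ ¬ Decoded m v then 1 else 0)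
      = (if c then q else 1 - q) * (1 - (if c then P.alphaC else P.alphaS) *
          (1 - (q * P.alphaC + (1 - q) * P.alphaS)) ^ (M - 1)) := by
  -- Non-decoding does not factor over nodes, but its complement does.
  have h1 : ∀ v : Fin M → Bool × Bool, (if (v m).1 = c ∧ ¬ Decoded m v then (1 : ℝ) else 0)
      = (if (v m).1 = c then 1 else 0) * ∏ j ∈ Finset.univ.erase m, (fun _ => (1 : ℝ)) (v j)
        - (if (v m).1 = c ∧ (v m).2 then 1 else 0) *
          ∏ j ∈ Finset.univ.erase m, (if (v j).2 then (0 : ℝ) else 1) := by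
    intro v
    have h2 : ((if (v m).1 = c ∧ (v m).2 then 1 else 0) : ℝ)
        = (if (v m).1 = c then 1 else 0) * (if (v m).2 then 1 else 0) := by
      split_ifs <;> simp_all
    rw [h2, mul_assoc, ← decoded_indicator]
    by_cases hc : (v m).1 = c <;> by_cases hd : Decoded m v <;> simp [hc, hd]
  simp_rw [h1, mul_sub, Finset.sum_sub_distrib]
  rw [sum_prod_nodeProb q P m (fun u => if u.1 = c then 1 else 0) (fun _ => 1),
    sum_prod_nodeProb q P m (fun u => if u.1 = c ∧ u.2 then 1 else 0)
      (fun u => if u.2 then 0 else 1), sum_nodeProb_idle]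
  simp only [mul_one, sum_nodeProb, one_pow]
  cases c <;> simp [Fintype.sum_prod_type, nodeProb] <;> ring

theorem sum_decoded (q : ℝ) (P : AccessPolicy) (m : Fin M) [∀ v, Decidable (Decoded m v)] :
    ∑ v : Fin M → Bool × Bool, (∏ j, nodeProb q P (v j)) * (if Decoded m v then 1 else 0)
      = (q * P.alphaC + (1 - q) * P.alphaS) *
          (1 - (q * P.alphaC + (1 - q) * P.alphaS)) ^ (M - 1) := by
  simp_rw [decoded_indicator]
  rw [sum_prod_nodeProb q P m (fun u => if u.2 then 1 else 0) (fun u => if u.2 then 0 else 1),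
    sum_nodeProb_idle]
  congr 1
  simp [Fintype.sum_prod_type, nodeProb]

theorem AccessPolicy.alphaC_mem (P : AccessPolicy) : 0 ≤ P.alphaC ∧ P.alphaC ≤ 1 := by
  cases P with
  | random α => exact α.2
  | reactive => simp [AccessPolicy.alphaC]
  | hybrid αc αs => exact αc.2

theorem AccessPolicy.alphaS_mem (P : AccessPolicy) : 0 ≤ P.alphaS ∧ P.alphaS ≤ 1 := by
  cases P with
  | random α => exact α.2
  | reactive => simp [AccessPolicy.alphaS]
  | hybrid αc αs => exact αs.2

theorem qBar_self {q : ℝ} (hq : 0 < q) : qBar q q = q := by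
  unfold qBar
  field_simp

theorem activity_self {q : ℝ} (hq : 0 < q) (P : AccessPolicy) :
    activity q q P = q * P.alphaC + (1 - q) * P.alphaS := by
  rw [activity, qBar_self hq]

theorem activity_mem {q : ℝ} (hq : 0 < q) (hq1 : q ≤ 1) (P : AccessPolicy) :
    0 ≤ activity q q P ∧ activity q q P ≤ 1 := by
  rw [activity_self hq]
  obtain ⟨c0, c1⟩ := P.alphaC_mem
  obtain ⟨s0, s1⟩ := P.alphaS_mem
  constructor <;> nlinarith

theorem successProb_mem {q : ℝ} (hq : 0 < q) (hq1 : q ≤ 1) (P : AccessPolicy) :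
    0 ≤ successProb M q q P ∧ successProb M q q P ≤ 1 := by
  obtain ⟨h0, h1⟩ := activity_mem hq hq1 P
  exact ⟨pow_nonneg (by linarith) _, pow_le_one₀ (by linarith) (by linarith)⟩

/-! ### The AoII as an error chain, and the throughput -/

/-- The error after a slot in terms of the source states and the previous estimate. -/
theorem err_cases : ∀ x y e : Fin 2,
    (((x : ℕ) : ℤ) - ((e : ℕ) : ℤ)).natAbs ≤ 1 ∧
    (((y : ℕ) : ℤ) - ((e : ℕ) : ℤ)).natAbs
      = (1 - (((x : ℕ) : ℤ) - ((e : ℕ) : ℤ)).natAbs) * (if x ≠ y then 1 else 0)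
        + (((x : ℕ) : ℤ) - ((e : ℕ) : ℤ)).natAbs * (if x = y then 1 else 0) := by
  decide

theorem err_le_one (X : Fin M → ℕ → Ω → Fin 2) (A : Fin M → ℕ → Ω → Bool) (E : Fin M → Ω → Fin 2)
    (m : Fin M) (n : ℕ) (ω : Ω) : err X A E m n ω ≤ 1 :=
  (err_cases _ (X m n ω) _).1

-- A delivery makes the estimate exact. Otherwise the estimate is kept, and over two symbols an
-- error appears or disappears exactly when the source changes.
open Classical in
theorem err_succ (X : Fin M → ℕ → Ω → Fin 2) (A : Fin M → ℕ → Ω → Bool) (E : Fin M → Ω → Fin 2)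
    (m : Fin M) (n : ℕ) (ω : Ω) :
    (err X A E m (n + 1) ω : ℝ) =
      (1 - (err X A E m n ω : ℝ)) *
        (if (step X A n ω m).1 = true ∧ ¬ Decoded m (step X A n ω) then 1 else 0) +
      (err X A E m n ω : ℝ) *
        (if (step X A n ω m).1 = false ∧ ¬ Decoded m (step X A n ω) then 1 else 0) := by
  have hdec : Decoded m (step X A n ω) ↔ Delivered A m (n + 1) ω := Iff.rfl
  have hle := err_le_one X A E m n ω
  by_cases hd : Delivered A m (n + 1) ω
  · have h0 : err X A E m (n + 1) ω = 0 := by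
      rw [err, estimate, if_pos hd]
      simp
    simp [h0, hdec, hd]
  · have h1 := (err_cases (X m n ω) (X m (n + 1) ω) (estimate X A E m n ω)).2
    have h2 : err X A E m (n + 1) ω
        = (((X m (n + 1) ω : ℕ) : ℤ) - ((estimate X A E m n ω : ℕ) : ℤ)).natAbs := by
      rw [err, estimate, if_neg hd]
    rw [h2, h1]
    change ((((1 - err X A E m n ω) * _ + err X A E m n ω * _ : ℕ)) : ℝ) = _
    push_cast [Nat.cast_sub hle]
    simp [hdec, hd, step]

theorem aoii_zero (X : Fin M → ℕ → Ω → Fin 2) (A : Fin M → ℕ → Ω → Bool) (E : Fin M → Ω → Fin 2)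
    (m : Fin M) (ω : Ω) : aoii X A E m 0 ω = 0 := by
  simp [aoii, errStart_zero]

theorem aoii_succ (X : Fin M → ℕ → Ω → Fin 2) (A : Fin M → ℕ → Ω → Bool) (E : Fin M → Ω → Fin 2)
    (m : Fin M) (n : ℕ) (ω : Ω) :
    aoii X A E m (n + 1) ω = (err X A E m (n + 1) ω : ℝ) * (aoii X A E m n ω + 1) :=
  age_recursion (δ := fun k => err X A E m k ω)
    (fun k => by have := err_le_one X A E m k ω; omega) n

namespace IsSystem

variable [MeasurableSpace Ω] {μ : Measure Ω} [IsProbabilityMeasure μ] {q : ℝ} {P : AccessPolicy}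
  {X : Fin M → ℕ → Ω → Fin 2} {A : Fin M → ℕ → Ω → Bool} {E : Fin M → Ω → Fin 2}

open Classical in
/-- The error of a symmetric source and its age of incorrect information form an error chain. -/
theorem isErrorChain (h : IsSystem μ q q P X A E) (hq : 0 < q) (m : Fin M) :
    IsErrorChain μ h.filtration (q * (1 - P.alphaC * successProb M q q P))
      ((1 - q) * (1 - P.alphaS * successProb M q q P))
      -- `step X A n` describes the passage from slot `n` to `n + 1`, hence the shift; the value at
      -- `n = 0` is never used.
      (fun n ω => if (step X A (n - 1) ω m).1 = true ∧ ¬ Decoded m (step X A (n - 1) ω)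
        then 1 else 0)
      (fun n ω => if (step X A (n - 1) ω m).1 = false ∧ ¬ Decoded m (step X A (n - 1) ω)
        then 1 else 0)
      (fun n ω => (err X A E m n ω : ℝ)) (aoii X A E m) where
  bdd_U n := h.bddMeas_step n fun v => if (v m).1 = true ∧ ¬ Decoded m v then 1 else 0
  bdd_W n := h.bddMeas_step n fun v => if (v m).1 = false ∧ ¬ Decoded m v then 1 else 0
  U_mem n ω := (ite_eq_or_eq _ _ _).symm
  W_mem n ω := (ite_eq_or_eq _ _ _).symm
  integral_U n f hf := by
    have := h.integral_mul_step n (fun v => if (v m).1 = true ∧ ¬ Decoded m v then 1 else 0) f hf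
    rw [sum_not_decoded, ← activity_self hq] at this
    exact this
  integral_W n f hf := by
    have := h.integral_mul_step n (fun v => if (v m).1 = false ∧ ¬ Decoded m v then 1 else 0) f hf
    rw [sum_not_decoded, ← activity_self hq] at this
    exact this
  init_err := by
    refine ⟨?_, 1, fun ω => ?_⟩
    · rintro s -
      exact ⟨(fun a => (((((a m).2.1 0 : Fin 2) : ℕ) : ℤ) - (((a m).1 : ℕ) : ℤ)).natAbs) ⁻¹'
        ((fun k : ℕ => (k : ℝ)) ⁻¹' s), .of_discrete, rfl⟩
    · rw [Nat.abs_cast]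
      exact_mod_cast err_le_one X A E m 0 ω
  init_mem ω := by
    have := err_le_one X A E m 0 ω
    rcases Nat.le_one_iff_eq_zero_or_eq_one.1 this with e | e <;> simp [e]
  init_age := aoii_zero X A E m
  err_succ := err_succ X A E m
  age_succ := aoii_succ X A E m

open Classical in
theorem throughput_succ (h : IsSystem μ q q P X A E) (hq : 0 < q) (n : ℕ) :
    throughput μ A (n + 1) = M * (activity q q P * successProb M q q P) := by
  have h1 : ∀ ω, (Set.ncard {m | Delivered A m (n + 1) ω} : ℝ)
      = ∑ m, if Decoded m (step X A n ω) then (1 : ℝ) else 0 := by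
    intro ω
    rw [Set.ncard_eq_toFinset_card', Finset.sum_boole]
    congr 2
    ext m
    simp only [Set.mem_toFinset, Finset.mem_filter, Finset.mem_univ, true_and]
    rfl
  rw [throughput]
  simp_rw [h1]
  rw [integral_finsetSum _ fun m _ => ((h.bddMeas_step n fun v =>
    if Decoded m v then 1 else 0).mono (h.filtration.le _)).integrable]
  rw [Finset.sum_congr rfl fun m _ => (h.integral_step n fun v => if Decoded m v then 1 else 0)]
  simp_rw [sum_decoded, ← activity_self hq]
  simp [successProb]

end IsSystem

end AlohaAoII

/-! ### Closed forms -/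

theorem mainTheorem3 {Ω : Type*} [MeasurableSpace Ω] (μ : Measure Ω) [IsProbabilityMeasure μ]
    (M : ℕ) (q01 q10 : ℝ) (hpos : 0 < q01) (hle : q01 ≤ 1) (hsymm : q01 = q10)
    (P : AccessPolicy)
    (X : Fin M → ℕ → Ω → Fin 2) (A : Fin M → ℕ → Ω → Bool) (E : Fin M → Ω → Fin 2)
    (hsys : IsSystem μ q01 q10 P X A E) (m : Fin M) :
    ∃ avg : ℝ,
      -- the time average of the AoII converges almost surely
      (∀ᵐ ω ∂μ, Tendsto (fun l : ℕ => (1 / (l : ℝ)) * ∑ i ∈ Finset.Icc 1 l, aoii X A E m i ω)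
        atTop (𝓝 avg)) ∧
      -- the expected AoII converges to the same value, unless the error process has period two
      (∀ n, Integrable (aoii X A E m n) μ) ∧
      ((q01 < 1 ∨ 0 < P.alphaC * successProb M q01 q10 P) →
        Tendsto (fun n => ∫ ω, aoii X A E m n ω ∂μ) atTop (𝓝 avg)) ∧
      -- closed form
      (let q := qBar q01 q10
       let γ := successProb M q01 q10 P
       let G := load M q01 q10 P
       avg = q * (M : ℝ) ^ 2 * (1 - P.alphaC * γ) /
        ((q * M * (1 - P.alphaC * γ) + G * γ) * (2 * q * M * (1 - P.alphaC * γ) + G * γ))) ∧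
      -- throughput form for the random policy
      (∀ α : unitInterval, P = AccessPolicy.random α → ∀ n ≥ 1,
        let q := qBar q01 q10
        let S := throughput μ A n
        avg = q * M * (M - S) /
          ((q * M + S * (1 - q)) * (2 * q * M + S * (1 - 2 * q)))) := by
  subst hsymm
  have hchain := hsys.isErrorChain hpos m
  have hthr := hsys.throughput_succ hpos
  have hact := activity_self hpos P
  obtain ⟨hγ0, hγ1⟩ := successProb_mem (M := M) hpos hle P
  obtain ⟨hc0, hc1⟩ := P.alphaC_mem
  obtain ⟨hs0, hs1⟩ := P.alphaS_mem
  have hM : (M : ℝ) ≠ 0 := by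
    have : 0 < M := m.pos
    positivity
  rw [load, qBar_self hpos]
  set γ := successProb M q01 q01 P with hγ
  set ρ := activity q01 q01 P with hρ
  have hcγ0 : 0 ≤ P.alphaC * γ := mul_nonneg hc0 hγ0
  have hcγ1 : P.alphaC * γ ≤ 1 := mul_le_one₀ hc1 hγ0 hγ1
  have hsγ0 : 0 ≤ P.alphaS * γ := mul_nonneg hs0 hγ0
  have hsγ1 : P.alphaS * γ ≤ 1 := mul_le_one₀ hs1 hγ0 hγ1
  set a := q01 * (1 - P.alphaC * γ) with ha
  set b := (1 - q01) * (1 - P.alphaS * γ) with hb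
  have ha0 : 0 ≤ a := mul_nonneg hpos.le (by linarith)
  have ha1 : a ≤ 1 := mul_le_one₀ hle (by linarith) (by linarith)
  have hb0 : 0 ≤ b := mul_nonneg (by linarith) (by linarith)
  have hb1 : b < 1 := by
    have : b ≤ (1 - q01) * 1 := mul_le_mul_of_nonneg_left (by linarith) (by linarith)
    linarith
  -- An error ends by a delivery or by an undelivered change of the source: these have probabilities
  -- `ρ γ` and `a`. Multiplying each of `1 - b` and `1 - b + a` by `M` then yields the stated
  -- denominator.
  have h1b : 1 - b = a + ρ * γ := by
    rw [ha, hb, hact]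
    ring
  have hformula : a / ((1 - b) * (1 - b + a)) = q01 * (M : ℝ) ^ 2 * (1 - P.alphaC * γ) /
      ((q01 * M * (1 - P.alphaC * γ) + ρ * M * γ) *
        (2 * q01 * M * (1 - P.alphaC * γ) + ρ * M * γ)) := by
    have e1 : q01 * (M : ℝ) ^ 2 * (1 - P.alphaC * γ) = (M : ℝ) ^ 2 * a := by rw [ha]; ring
    have e2 : (q01 * M * (1 - P.alphaC * γ) + ρ * M * γ) *
        (2 * q01 * M * (1 - P.alphaC * γ) + ρ * M * γ)
        = (M : ℝ) ^ 2 * ((1 - b) * (1 - b + a)) := by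
      rw [h1b, ha]
      ring
    rw [e1, e2, mul_div_mul_left _ _ (pow_ne_zero 2 hM)]
  refine ⟨a / ((1 - b) * (1 - b + a)), ?_, hchain.integrable_age, ?_, hformula, ?_⟩
  · filter_upwards [hchain.ae_tendsto_average ha0 ha1 hb0 hb1] with ω hω
    refine hω.congr fun l => ?_
    rw [Finset.range_eq_Ico, Finset.sum_Ico_add' (fun i => aoii X A E m i ω) 0 l 1, zero_add,
      ← Finset.Ico_add_one_right_eq_Icc, div_eq_inv_mul, one_div]
  · intro hcond
    refine hchain.tendsto_integral_age ha0 ?_ hb0 hb1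
    -- Either alternative forces `a < 1`, through `a ≤ q01` or `a ≤ 1 - P.alphaC * γ`.
    rcases hcond with hq | hq
    · exact (mul_le_of_le_one_right hpos.le (by linarith)).trans_lt hq
    · exact (mul_le_of_le_one_left (by linarith) hle).trans_lt (by linarith)
  · rintro α rfl n hn
    obtain ⟨k, rfl⟩ : ∃ k, n = k + 1 := ⟨n - 1, by omega⟩
    -- For the random policy `ρ = α_c`, so `α_c γ = S / M` and `G γ = S`.
    have hρα : ρ = (AccessPolicy.random α).alphaC := by
      rw [hact]
      simp only [AccessPolicy.alphaC, AccessPolicy.alphaS]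
      ring
    intro q S
    have hS : S = M * (ρ * γ) := hthr k
    rw [hformula, ← hρα, hS]
    congr 1 <;> ring
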